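/- Theorem. Let $A$ be a finite set with $|A|\ge 2$, let $\bar A=\{\bar a: a\in A\}$ be a disjoint copy of $A$, and let $\Sigma=A\cup\bar A$. The free monoid $\Sigma^*$ acts on $A^*\cup\{\bot\}$ by $$q.\varepsilon=q,\qquad q.au=qa.u,\qquad q.\bar a u=\begin{cases}q'.u&\text{if } q=aq',\\ \bot&\text{otherwise,}\end{cases}\qquad \bot.u=\bot$$ for $q\in A^*$, $a\in A$, $u\in\Sigma^*$. Write $u\equiv v$ if $q.u=q.v$ for all $q\in A^*$; this is a congruence on $\Sigma^*$, and $\mathcal Q=\Sigma^*/{\equiv}$ is called the monoid of queue actions. For an alphabet $\Gamma$ and a symbol $\diamond\notin\Gamma$, the convolution $u\otimes v$ of two words $u,v\in\Gamma^*$ is the word over $(\Gamma\cup\{\diamond\})^2\setminus\{(\diamond,\diamond)\}$ obtained by padding the shorter of the two words at its end with $\diamond$ to the length of the longer one and reading the pair letter by letter. An automatic presentation of a monoid $M$ is a triple $(\Gamma,\theta,L)$ consisting of a finite alphabet $\Gamma$, a semigroup morphism $\theta\colon\Gamma^+\to M$ and a language $L\subseteq\Gamma^+$ such that $\theta$ maps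 $L$ bijectively onto $M$, the language $L$ is regular, and for every $a\in\Gamma$ the language $$L_a=\{u\otimes v : u,v\in L,\ \theta(ua)=\theta(v)\}$$ is regular. A monoid is Thurston-automatic if it has some automatic presentation. Then the monoid of queue actions $\mathcal Q$ is not Thurston-automatic. -/

import Mathlib

universe u v

/-- The atomic queue actions over `A`: the alphabet `Σ = A ∪ Ā`, where `write a` is the letter `a`
(append `a` at the end of the queue) and `read a` is the letter `ā` (remove `a` from the front). -/
inductive QueueLetter (A : Type u) : Type u where
  | write (a : A) : QueueLetter A
  | read (a : A) : QueueLetter A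

open Classical in
/-- The action `q.w` of a word `w ∈ Σ*` on a queue `q ∈ A* ∪ {⊥}`; `none` is the error state `⊥`. -/
noncomputable def queueAct {A : Type u} : Option (List A) → List (QueueLetter A) → Option (List A)
  | none, _ => none
  | some q, [] => some q
  | some q, QueueLetter.write a :: w => queueAct (some (q ++ [a])) w
  | some [], QueueLetter.read _ :: _ => none
  | some (b :: q), QueueLetter.read a :: w => if b = a then queueAct (some q) w else none

theorem queueAct_append {A : Type u} (x : Option (List A)) (v w : List (QueueLetter A)) :
    queueAct x (v ++ w) = queueAct (queueAct x v) w := by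
  induction v generalizing x with
  | nil => cases x <;> simp [queueAct]
  | cons c v ih =>
    rcases x with _ | q
    · simp [queueAct]
    · rcases c with a | a
      · simp [queueAct, ih]
      · rcases q with _ | ⟨b, q⟩
        · simp [queueAct]
        · by_cases h : b = a <;> simp [queueAct, ih, h]

/-- The congruence `≡` on `Σ*`: two words are equivalent if they act equally on all queues
`q ∈ A*`. -/
def queueCon (A : Type u) : Con (FreeMonoid (QueueLetter A)) where
  r v w := ∀ q : List A,
    queueAct (some q) (FreeMonoid.toList v) = queueAct (some q) (FreeMonoid.toList w)
  iseqv := ⟨fun _ _ => rfl, fun h q => (h q).symm, fun h h' q => (h q).trans (h' q)⟩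
  mul' := by
    intro w x y z h h' q
    rw [FreeMonoid.toList_mul, FreeMonoid.toList_mul, queueAct_append, queueAct_append, h q]
    cases queueAct (some q) (FreeMonoid.toList x) with
    | none => simp [queueAct]
    | some q' => exact h' q'

/-- The monoid of queue actions `Q = Σ* / ≡`. -/
abbrev QueueMonoid (A : Type u) : Type u := (queueCon A).Quotient

/-- The alphabet `Γ(2,⋄) = (Γ ∪ {⋄})² ∖ {(⋄,⋄)}`, where `none` is the padding symbol `⋄`. -/
abbrev PadPair (Γ : Type v) : Type v := {p : Option Γ × Option Γ // p ≠ (none, none)}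

/-- The convolution `v ⊗ w` of two words. -/
def convolution {Γ : Type v} : List Γ → List Γ → List (PadPair Γ)
  | [], [] => []
  | a :: v, [] => ⟨(some a, none), by simp⟩ :: convolution v []
  | [], b :: w => ⟨(none, some b), by simp⟩ :: convolution [] w
  | a :: v, b :: w => ⟨(some a, some b), by simp⟩ :: convolution v w

/-- The underlying word of an element of the free semigroup `Γ⁺`. -/
def FreeSemigroup.word {Γ : Type v} (x : FreeSemigroup Γ) : List Γ := x.head :: x.tail

/-- The language `L_a = {u ⊗ v | u, v ∈ L, θ(ua) = θ(v)}`. -/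
def rightMulLanguage {M : Type u} [Monoid M] {Γ : Type v} (θ : FreeSemigroup Γ →ₙ* M)
    (L : Set (FreeSemigroup Γ)) (a : Γ) : Language (PadPair Γ) :=
  {x | ∃ s ∈ L, ∃ t ∈ L, θ (s * FreeSemigroup.of a) = θ t ∧ x = convolution s.word t.word}

/-- `(Γ, θ, L)` is an automatic presentation of the monoid `M`
(here `θ : Γ⁺ → M` is a semigroup morphism and `L ⊆ Γ⁺`). -/
structure IsAutomaticPresentation {M : Type u} [Monoid M] {Γ : Type v}
    (θ : FreeSemigroup Γ →ₙ* M) (L : Set (FreeSemigroup Γ)) : Prop where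
  finite_alphabet : Finite Γ
  bijOn : Set.BijOn θ L Set.univ
  regular : Language.IsRegular (FreeSemigroup.word '' L : Set (List Γ))
  regular_rightMul : ∀ a : Γ, (rightMulLanguage θ L a).IsRegular

/-- A monoid is Thurston-automatic if it has some automatic presentation. -/
def IsThurstonAutomatic (M : Type u) [Monoid M] : Prop :=
  ∃ (Γ : Type v) (θ : FreeSemigroup Γ →ₙ* M) (L : Set (FreeSemigroup Γ)),
    IsAutomaticPresentation θ L

/-! The balance of a word (writes minus reads) is an invariant of `≡`, since some queue survives the
word and its change in length is the balance. In an automatic presentation, the pairs in each `L_a`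
therefore have a constant balance difference. A finite automaton then keeps the difference bounded
at all common positions (`Language.IsRegular.exists_prefix_sum_bound`), and by chaining the same
holds for right multiplication by any fixed element
(`IsAutomaticPresentation.exists_balance_bound`).

For `a ≠ b`, the actions `bⁿ b̄ⁿ` and `b̄ⁿ bⁿ` become equal after a further `ā`, so their
representatives in `L` have prefix balances at bounded distance from those of a common third
representative. But `bⁿ b̄ⁿ` is defined on the empty queue, so no prefix of a representative has
negative balance, whereas every representative of `b̄ⁿ bⁿ` has a prefix of balance about `-n`
(`exists_prefix_balance_le`). Large `n` gives a contradiction. -/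

/-! ### Queue actions -/

section Queue

variable {A : Type u}

/-- The contribution of a letter to the length of the queue. -/
def QueueLetter.weight : QueueLetter A → ℤ
  | write _ => 1
  | read _ => -1

/-- The letter of `A` underlying an atomic action. -/
def QueueLetter.letter : QueueLetter A → A
  | write a => a
  | read a => a

/-- The number of writes minus the number of reads in a word of atomic actions. -/
def balance (w : List (QueueLetter A)) : ℤ := (w.map QueueLetter.weight).sum

@[simp] theorem balance_nil : balance ([] : List (QueueLetter A)) = 0 := rfl

@[simp] theorem balance_cons (c : QueueLetter A) (w : List (QueueLetter A)) :
    balance (c :: w) = c.weight + balance w := by simp [balance]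

theorem balance_append (v w : List (QueueLetter A)) :
    balance (v ++ w) = balance v + balance w := by simp [balance]

theorem abs_balance_le_length (w : List (QueueLetter A)) : |balance w| ≤ w.length := by
  induction w with
  | nil => simp
  | cons c w ih =>
    have hc : |c.weight| = 1 := by cases c <;> simp [QueueLetter.weight]
    have := abs_add_le c.weight (balance w)
    simp only [balance_cons, List.length_cons, Nat.cast_add, Nat.cast_one]
    linarith

/-- The word of letters read by `w`. -/
def readWord : List (QueueLetter A) → List A
  | [] => []
  | QueueLetter.write _ :: w => readWord w
  | QueueLetter.read a :: w => a :: readWord w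

/-- The word of letters written by `w`. -/
def writeWord : List (QueueLetter A) → List A
  | [] => []
  | QueueLetter.write a :: w => a :: writeWord w
  | QueueLetter.read _ :: w => writeWord w

theorem length_of_queueAct_eq_some {w : List (QueueLetter A)} {q r : List A}
    (h : queueAct (some q) w = some r) : (r.length : ℤ) = q.length + balance w := by
  induction w generalizing q with
  | nil => simp_all [queueAct]
  | cons c w ih =>
    rcases c with a | a
    · have := ih h
      simp [QueueLetter.weight] at this ⊢
      linarith
    · rcases q with _ | ⟨b, q⟩
      · simp [queueAct] at h
      · by_cases hb : b = a
        · have := ih (by simpa [queueAct, hb] using h)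
          simp [QueueLetter.weight] at this ⊢
          linarith
        · simp [queueAct, hb] at h

theorem readWord_append_of_queueAct_eq_some {w : List (QueueLetter A)} {q r : List A}
    (h : queueAct (some q) w = some r) : readWord w ++ r = q ++ writeWord w := by
  induction w generalizing q with
  | nil => simp_all [queueAct, readWord, writeWord]
  | cons c w ih =>
    rcases c with a | a
    · simpa [readWord, writeWord] using ih h
    · rcases q with _ | ⟨b, q⟩
      · simp [queueAct] at h
      · by_cases hb : b = a
        · simpa [readWord, writeWord, hb] using ih (q := q) (by simpa [queueAct, hb] using h)
        · simp [queueAct, hb] at h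

/-- No word acts as `⊥` everywhere: a queue that begins with all letters to be read never fails.
This supplies the queue on which balances of equivalent words are compared. -/
theorem exists_queueAct_readWord_append (w : List (QueueLetter A)) (z : List A) :
    ∃ r, queueAct (some (readWord w ++ z)) w = some r := by
  induction w generalizing z with
  | nil => exact ⟨z, by simp [queueAct, readWord]⟩
  | cons c w ih =>
    rcases c with a | a
    · simpa [queueAct, readWord] using ih (z ++ [a])
    · simpa [queueAct, readWord] using ih z

theorem balance_eq_of_queueAct_eq {v w : List (QueueLetter A)}
    (h : ∀ q : List A, queueAct (some q) v = queueAct (some q) w) : balance v = balance w := by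
  obtain ⟨r, hr⟩ := exists_queueAct_readWord_append v []
  have h1 := length_of_queueAct_eq_some hr
  have h2 := length_of_queueAct_eq_some ((h _).symm.trans hr)
  linarith

/-- Starting from the empty queue, the balance of a prefix is the length of the intermediate queue.
-/
theorem balance_nonneg_of_prefix {v w : List (QueueLetter A)} (hv : v <+: w)
    (h : queueAct (some []) w ≠ none) : 0 ≤ balance v := by
  obtain ⟨v', rfl⟩ := hv
  rw [queueAct_append] at h
  cases hr : queueAct (some []) v with
  | none => simp [hr, queueAct] at h
  | some r =>
    have := length_of_queueAct_eq_some hr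
    simp at this
    linarith

theorem letter_eq_of_words {b : A} {w : List (QueueLetter A)} (hr : ∀ x ∈ readWord w, x = b)
    (hw : ∀ x ∈ writeWord w, x = b) : ∀ c ∈ w, c.letter = b := by
  induction w with
  | nil => simp
  | cons c w ih =>
    rcases c with a | a <;> simp_all [readWord, writeWord, QueueLetter.letter]

/-- With a single letter the queue is just a counter, and a read can fail only at zero. -/
theorem queueAct_replicate_ne_none {b : A} {w : List (QueueLetter A)} (hb : ∀ c ∈ w, c.letter = b)
    (m : ℕ) (h : ∀ v, v <+: w → 0 ≤ (m : ℤ) + balance v) :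
    queueAct (some (List.replicate m b)) w ≠ none := by
  induction w generalizing m with
  | nil => simp [queueAct]
  | cons c w ih =>
    have hb' : ∀ c ∈ w, c.letter = b := fun d hd => hb d (List.mem_cons_of_mem _ hd)
    have hc := hb c List.mem_cons_self
    rcases c with a | a
    · obtain rfl : a = b := hc
      have := ih hb' (m + 1) fun v hv => by
        have := h (QueueLetter.write a :: v) (by simpa using hv)
        simp [QueueLetter.weight] at this ⊢
        linarith
      simpa [queueAct, List.replicate_succ'] using this
    · obtain rfl : a = b := hc
      rcases m with _ | m
      · have := h [QueueLetter.read a] (by simp)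
        simp [QueueLetter.weight] at this
      · have := ih hb' m fun v hv => by
          have := h (QueueLetter.read a :: v) (by simpa using hv)
          simp [QueueLetter.weight] at this ⊢
          linarith
        simpa [queueAct, List.replicate_succ] using this

theorem queueAct_map_write (q y : List A) :
    queueAct (some q) (y.map QueueLetter.write) = some (q ++ y) := by
  induction y generalizing q with
  | nil => simp [queueAct]
  | cons a y ih => simp [queueAct, ih]

theorem queueAct_map_read_eq_some {q x r : List A} :
    queueAct (some q) (x.map QueueLetter.read) = some r ↔ q = x ++ r := by
  induction x generalizing q with
  | nil => simp [queueAct]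
  | cons a x ih =>
    rcases q with _ | ⟨b, q⟩
    · simp [queueAct]
    · by_cases hb : b = a <;> simp [queueAct, hb, ih]

/-- The word `bⁿ b̄ⁿ`. -/
def writeRead (b : A) (n : ℕ) : List (QueueLetter A) :=
  (List.replicate n b).map QueueLetter.write ++ (List.replicate n b).map QueueLetter.read

/-- The word `b̄ⁿ bⁿ`. -/
def readWrite (b : A) (n : ℕ) : List (QueueLetter A) :=
  (List.replicate n b).map QueueLetter.read ++ (List.replicate n b).map QueueLetter.write

theorem queueAct_writeRead_eq_some {b : A} {n : ℕ} {q r : List A} :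
    queueAct (some q) (writeRead b n) = some r ↔
      q ++ List.replicate n b = List.replicate n b ++ r := by
  rw [writeRead, queueAct_append, queueAct_map_write, queueAct_map_read_eq_some]

theorem queueAct_readWrite_eq_some {b : A} {n : ℕ} {q r : List A} :
    queueAct (some q) (readWrite b n) = some r ↔
      ∃ z, q = List.replicate n b ++ z ∧ r = z ++ List.replicate n b := by
  rw [readWrite, queueAct_append]
  cases h : queueAct (some q) ((List.replicate n b).map QueueLetter.read) with
  | none =>
    simp only [queueAct, reduceCtorEq, false_iff]
    rintro ⟨z, hz, -⟩
    rw [queueAct_map_read_eq_some.2 hz] at h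
    cases h
  | some z =>
    have hz := queueAct_map_read_eq_some.1 h
    rw [queueAct_map_write, Option.some_inj]
    constructor
    · rintro rfl
      exact ⟨z, hz, rfl⟩
    · rintro ⟨z', hz', rfl⟩
      rw [List.append_cancel_left (hz.symm.trans hz')]

theorem queueAct_append_read_eq_some {a : A} {w : List (QueueLetter A)} {q r : List A} :
    queueAct (some q) (w ++ [QueueLetter.read a]) = some r ↔
      queueAct (some q) w = some (a :: r) := by
  rw [queueAct_append]
  cases h : queueAct (some q) w with
  | none => simp [queueAct]
  | some z => simpa using queueAct_map_read_eq_some (q := z) (x := [a]) (r := r)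

/-- Reading `a ≠ b` makes the overlap of `bⁿ` with `b̄ⁿ` invisible. -/
theorem queueAct_writeRead_append_read {a b : A} (hab : a ≠ b) (n : ℕ) (q : List A) :
    queueAct (some q) (writeRead b n ++ [QueueLetter.read a]) =
      queueAct (some q) (readWrite b n ++ [QueueLetter.read a]) := by
  ext r
  rw [queueAct_append_read_eq_some, queueAct_append_read_eq_some, queueAct_writeRead_eq_some,
    queueAct_readWrite_eq_some]
  constructor
  · intro h
    -- If `q` is no longer than `bⁿ`, the remaining `a :: r` is a suffix of `bⁿ`, which is
    -- impossible as `a ≠ b`.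
    rcases List.append_eq_append_iff.1 h with ⟨z, hz, hz'⟩ | ⟨z, hz, hz'⟩
    · have : a ∈ List.replicate n b := by simp [hz']
      exact absurd (List.eq_of_mem_replicate this) hab
    · exact ⟨z, hz, hz'⟩
  · rintro ⟨z, rfl, h⟩
    rw [h, List.append_assoc]

theorem queueAct_nil_writeRead (b : A) (n : ℕ) :
    queueAct (some []) (writeRead b n) = some [] := by
  simp [queueAct_writeRead_eq_some]

/-- A successful run on a long power of `b` forces every letter of `w` to be `b` or `b̄`. Such a
word fails on a power of `b` only by exhausting it, and it must fail on the power one short of what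
`readWrite` needs. -/
theorem exists_prefix_balance_le {b : A} {n : ℕ} {w : List (QueueLetter A)}
    (h : ∀ q : List A, queueAct (some q) w = queueAct (some q) (readWrite b n)) :
    ∃ v, v <+: w ∧ balance v ≤ -n := by
  rcases n with _ | n
  · exact ⟨[], by simp, by simp⟩
  set k := (readWord w).length
  -- The length exceeds both the reads of `readWrite` and the `k` reads of `w`, so the read and
  -- written words of `w` are a prefix and a suffix of this queue.
  have hrun : queueAct (some (List.replicate (n + 1 + k) b)) w =
      some (List.replicate (n + 1 + k) b) := by
    rw [h, queueAct_readWrite_eq_some]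
    exact ⟨List.replicate k b, by simp, by simp [add_comm]⟩
  have heq := readWord_append_of_queueAct_eq_some hrun
  have hlen : k = (writeWord w).length := by
    have := congrArg List.length heq
    simp only [List.length_append, List.length_replicate] at this
    omega
  have hread : ∀ x ∈ readWord w, x = b := by
    have hp : readWord w <+: List.replicate (n + 1 + k) b :=
      List.prefix_of_prefix_length_le (List.prefix_append _ _) (heq.symm ▸ List.prefix_append _ _)
        (by simp [k])
    exact fun x hx => List.eq_of_mem_replicate (hp.subset hx)
  have hwrite : ∀ x ∈ writeWord w, x = b := by
    have hs : writeWord w <:+ List.replicate (n + 1 + k) b :=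
      List.suffix_of_suffix_length_le (List.suffix_append _ _) (heq ▸ List.suffix_append _ _)
        (by simp [← hlen])
    exact fun x hx => List.eq_of_mem_replicate (hs.subset hx)
  by_contra! hv
  refine queueAct_replicate_ne_none (letter_eq_of_words hread hwrite) n
    (fun v hvw => by have := hv v hvw; push_cast at this; linarith) ?_
  rw [h, Option.eq_none_iff_forall_ne_some]
  intro r hr
  obtain ⟨z, hz, -⟩ := queueAct_readWrite_eq_some.1 hr
  have := congrArg List.length hz
  simp at this
  omega

/-- Moving the cut back to the start of the `σ`-block in which `v` ends removes at most `c` atomic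
actions. -/
theorem exists_take_balance_le {Γ : Type v} (σ : Γ → List (QueueLetter A)) {c : ℕ}
    (hσ : ∀ g, (σ g).length ≤ c) (l : List Γ) {v : List (QueueLetter A)}
    (hv : v <+: l.flatMap σ) : ∃ p, balance ((l.take p).flatMap σ) ≤ balance v + c := by
  induction l generalizing v with
  | nil =>
    obtain rfl : v = [] := by simpa using hv
    exact ⟨0, by simp⟩
  | cons g l ih =>
    rw [List.flatMap_cons] at hv
    obtain ⟨s, hs⟩ := hv
    rcases List.append_eq_append_iff.1 hs with ⟨s', h, -⟩ | ⟨v', rfl, hv'⟩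
    · replace h : v <+: σ g := ⟨s', h.symm⟩
      refine ⟨0, ?_⟩
      have h1 := abs_le.1 (abs_balance_le_length v)
      have h2 : (v.length : ℤ) ≤ c := by exact_mod_cast h.length_le.trans (hσ g)
      simp only [List.take_zero, List.flatMap_nil, balance_nil]
      linarith
    · obtain ⟨p, hp⟩ := ih ⟨s, hv'.symm⟩
      refine ⟨p + 1, ?_⟩
      rw [List.take_succ_cons, List.flatMap_cons, balance_append, balance_append]
      linarith

end Queue

/-! ### Regular languages and convolutions -/

/-- An additive function that is constant on a regular language is bounded on the prefixes of
its words. -/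
theorem Language.IsRegular.exists_prefix_sum_bound {α : Type*} {R : Language α} (hR : R.IsRegular)
    (f : α → ℤ) (k : ℤ) (hk : ∀ z ∈ R, (z.map f).sum = k) :
    ∃ B : ℤ, ∀ z z', z ++ z' ∈ R → |(z.map f).sum| ≤ B := by
  obtain ⟨σ, _, M, rfl⟩ := hR
  -- The state reached determines the sum: a fixed accepted continuation `y` completes every such
  -- prefix to total `k`. States with no accepted continuation get the dummy value `0`.
  have hval : ∀ s : σ, ∃ m : ℤ, ∀ z z', M.eval z = s → z ++ z' ∈ M.accepts →
      (z.map f).sum = m := by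
    intro s
    by_cases hs : ∃ y, M.evalFrom s y ∈ M.accept
    · obtain ⟨y, hy⟩ := hs
      refine ⟨k - (y.map f).sum, fun z z' hz _ => ?_⟩
      have := hk (z ++ y) (by
        rw [DFA.mem_accepts, DFA.eval, DFA.evalFrom_of_append]
        rw [← hz] at hy
        exact hy)
      rw [List.map_append, List.sum_append] at this
      linarith
    · refine ⟨0, fun z z' hz hz' => absurd ⟨z', ?_⟩ hs⟩
      rw [DFA.mem_accepts, DFA.eval, DFA.evalFrom_of_append] at hz'
      rw [← hz]
      exact hz'
  choose m hm using hval
  refine ⟨∑ s, |m s|, fun z z' hz => ?_⟩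
  rw [hm _ z z' rfl hz]
  exact Finset.single_le_sum (f := fun s => |m s|) (fun s _ => abs_nonneg _) (Finset.mem_univ _)

theorem take_convolution {Γ : Type v} (u w : List Γ) (p : ℕ) :
    (convolution u w).take p = convolution (u.take p) (w.take p) := by
  induction p generalizing u w with
  | zero => simp [convolution]
  | succ p ih => rcases u with _ | ⟨a, u⟩ <;> rcases w with _ | ⟨b, w⟩ <;> simp [convolution, ih]

/-- The difference of the values of `d` on the two components of a padded pair. -/
def pairDiff {Γ : Type v} (d : Γ → ℤ) (x : PadPair Γ) : ℤ :=
  x.1.1.elim 0 d - x.1.2.elim 0 d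

theorem sum_pairDiff_convolution {Γ : Type v} (d : Γ → ℤ) (u w : List Γ) :
    ((convolution u w).map (pairDiff d)).sum = (u.map d).sum - (w.map d).sum := by
  induction u generalizing w with
  | nil =>
    induction w with
    | nil => simp [convolution]
    | cons b w ih => simp [convolution, ih, pairDiff]; ring
  | cons a u ih => rcases w with _ | ⟨b, w⟩ <;> simp [convolution, ih, pairDiff]; ring

theorem FreeSemigroup.word_mul {Γ : Type v} (x y : FreeSemigroup Γ) :
    (x * y).word = x.word ++ y.word := rfl

theorem FreeSemigroup.word_of {Γ : Type v} (a : Γ) : (FreeSemigroup.of a).word = [a] := rfl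

/-! ### Balances along representatives -/

section Presentation

variable {A : Type u} {Γ : Type v} {θ : FreeSemigroup Γ →ₙ* QueueMonoid A}
  {L : Set (FreeSemigroup Γ)} {σ : Γ → List (QueueLetter A)}

/-- The element of the monoid of queue actions represented by a word. -/
def queueMk (w : List (QueueLetter A)) : QueueMonoid A :=
  (FreeMonoid.ofList w : (queueCon A).Quotient)

theorem queueMk_append (v w : List (QueueLetter A)) :
    queueMk (v ++ w) = queueMk v * queueMk w := rfl

theorem queueMk_eq_iff {v w : List (QueueLetter A)} :
    queueMk v = queueMk w ↔ ∀ q : List A, queueAct (some q) v = queueAct (some q) w :=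
  (queueCon A).eq

theorem queueMk_surjective : Function.Surjective (queueMk (A := A)) := fun x =>
  Con.induction_on x fun w => ⟨FreeMonoid.toList w, rfl⟩

theorem queueMk_flatMap_word (hσ : ∀ g, queueMk (σ g) = θ (FreeSemigroup.of g))
    (x : FreeSemigroup Γ) : queueMk (x.word.flatMap σ) = θ x := by
  induction x using FreeSemigroup.recOnMul with
  | ih1 g => simpa [FreeSemigroup.word_of] using hσ g
  | ih2 g y hg hy =>
    rw [FreeSemigroup.word_mul, List.flatMap_append, queueMk_append, map_mul, hg, hy]

theorem balance_flatMap (l : List Γ) :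
    balance (l.flatMap σ) = (l.map fun g => balance (σ g)).sum := by
  induction l with
  | nil => simp
  | cons g l ih => simp [balance_append, ih]

/-- For one letter, the balance difference is constant on `L_g`, so it is bounded on prefixes of
convolutions. Longer `t` are handled through representatives in `L` of the intermediate products,
adding the bounds. -/
theorem IsAutomaticPresentation.exists_balance_bound (hP : IsAutomaticPresentation θ L)
    (hσ : ∀ g, queueMk (σ g) = θ (FreeSemigroup.of g)) (t : FreeSemigroup Γ) :
    ∃ B : ℤ, ∀ x ∈ L, ∀ y ∈ L, θ (x * t) = θ y → ∀ p,
      |balance ((x.word.take p).flatMap σ) - balance ((y.word.take p).flatMap σ)| ≤ B := by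
  induction t using FreeSemigroup.recOnMul with
  | ih1 g =>
    obtain ⟨B, hB⟩ := (hP.regular_rightMul g).exists_prefix_sum_bound
      (pairDiff fun g => balance (σ g)) (-balance (σ g)) (by
        rintro _ ⟨x, -, y, -, hxy, rfl⟩
        rw [← queueMk_flatMap_word hσ, ← queueMk_flatMap_word hσ, queueMk_eq_iff] at hxy
        have := balance_eq_of_queueAct_eq hxy
        rw [FreeSemigroup.word_mul, List.flatMap_append, balance_append, FreeSemigroup.word_of,
          List.flatMap_singleton] at this
        rw [sum_pairDiff_convolution, ← balance_flatMap, ← balance_flatMap]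
        linarith)
    refine ⟨B, fun x hx y hy hxy p => ?_⟩
    have := hB ((convolution x.word y.word).take p) ((convolution x.word y.word).drop p) (by
      rw [List.take_append_drop]
      exact ⟨x, hx, y, hy, hxy, rfl⟩)
    rwa [take_convolution, sum_pairDiff_convolution, ← balance_flatMap, ← balance_flatMap] at this
  | ih2 g t hg ht =>
    obtain ⟨B, hB⟩ := hg
    obtain ⟨B', hB'⟩ := ht
    refine ⟨B + B', fun x hx y hy hxy p => ?_⟩
    obtain ⟨z, hz, hxz⟩ := hP.bijOn.surjOn (Set.mem_univ (θ (x * FreeSemigroup.of g)))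
    have h1 := hB x hx z hz hxz.symm p
    have h2 := hB' z hz y hy (by rw [map_mul, hxz, ← map_mul, mul_assoc, hxy]) p
    exact (abs_sub_le _ _ _).trans (add_le_add h1 h2)

end Presentation

theorem mainTheorem5 (A : Type u) [Finite A] (hA : 2 ≤ Nat.card A) :
    ¬ IsThurstonAutomatic.{u, v} (QueueMonoid A) := by
  rintro ⟨Γ, θ, L, hP⟩
  have := hP.finite_alphabet
  have := Finite.one_lt_card_iff_nontrivial.1 hA
  obtain ⟨a, b, hab⟩ := exists_pair_ne A
  choose σ hσ using fun g => queueMk_surjective (θ (FreeSemigroup.of g))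
  obtain ⟨c, hc⟩ : ∃ c, ∀ g, (σ g).length ≤ c := by
    obtain ⟨c, hc⟩ := (Set.finite_range fun g => (σ g).length).bddAbove
    exact ⟨c, fun g => hc ⟨g, rfl⟩⟩
  have hrep : ∀ m, ∃ x ∈ L, θ x = m := fun m => hP.bijOn.surjOn (Set.mem_univ m)
  obtain ⟨t, -, ht⟩ := hrep (queueMk [QueueLetter.read a])
  obtain ⟨B, hB⟩ := hP.exists_balance_bound hσ t
  -- At one position `p` the prefix of `x` has balance at least `0` and that of `y` at most `c - n`,
  -- yet both are within `B` of that of `z`; hence `n` must exceed `c + 2B`.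
  set n : ℕ := c + 2 * B.toNat + 1 with hn
  obtain ⟨x, hx, hxn⟩ := hrep (queueMk (writeRead b n))
  obtain ⟨y, hy, hyn⟩ := hrep (queueMk (readWrite b n))
  obtain ⟨z, hz, hxz⟩ := hrep (θ (x * t))
  have hyz : θ (y * t) = θ z := by
    rw [hxz, map_mul, map_mul, hxn, hyn, ht, ← queueMk_append, ← queueMk_append, queueMk_eq_iff]
    exact fun q => (queueAct_writeRead_append_read hab n q).symm
  rw [← queueMk_flatMap_word hσ, queueMk_eq_iff] at hxn hyn
  obtain ⟨v, hv, hvn⟩ := exists_prefix_balance_le hyn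
  obtain ⟨p, hp⟩ := exists_take_balance_le σ hc y.word hv
  have h1 := abs_le.1 (hB x hx z hz hxz.symm p)
  have h2 := abs_le.1 (hB y hy z hz hyz p)
  have hpre : (x.word.take p).flatMap σ <+: x.word.flatMap σ :=
    ⟨(x.word.drop p).flatMap σ, by rw [← List.flatMap_append, List.take_append_drop]⟩
  have h3 := balance_nonneg_of_prefix hpre (by simp [hxn, queueAct_nil_writeRead])
  omega
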